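/- There exist a $\sigma$-finite measure space $(\Omega,\mu)$ and a strongly continuous semigroup $(e^{tD})_{t\ge 0}$ of bounded linear operators on the complex space $L_2(\Omega,\mu)$, with (in general unbounded) generator $D$, such that every $e^{tD}$ is positive (it maps functions that are $\ge 0$ almost everywhere to functions that are $\ge 0$ almost everywhere), such that $$(1+i\mathbb R)\cap\sigma(D)=\emptyset ,$$ but $$e^{2\pi}\in\sigma(e^{2\pi D}).$$ Consequently, for this positive semigroup it is not true that for all real $a$ and all $t>0$ one has $$(a+i\mathbb R)\cap\sigma(D)=\emptyset\iff \{z\in\mathbb C:|z|=e^{ta}\}\cap\sigma(e^{tD})=\emptyset ;$$ that is, the spectrum of the generator does not characterize the dichotomy of positive semigroups on $L_2$ spaces. -/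

import Mathlib

open MeasureTheory Filter Topology
open scoped NNReal ENNReal

/-- A strongly continuous one-parameter semigroup (C₀-semigroup) of bounded linear operators
on a complex normed space. -/
structure C0Semigroup (X : Type*) [NormedAddCommGroup X] [NormedSpace ℂ X] where
  /-- The operator at time `t ≥ 0`. -/
  op : ℝ≥0 → X →L[ℂ] X
  op_zero : op 0 = ContinuousLinearMap.id ℂ X
  op_add : ∀ s t : ℝ≥0, op (s + t) = (op s).comp (op t)
  strong_cont : ∀ x : X, Continuous fun t : ℝ≥0 => op t x

namespace C0Semigroup

variable {X : Type*} [NormedAddCommGroup X] [NormedSpace ℂ X]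

/-- The difference quotient `(T(t) x - x) / t`. -/
noncomputable def quotient (T : C0Semigroup X) (x : X) (t : ℝ≥0) : X :=
  (((t : ℝ) : ℂ))⁻¹ • (T.op t x - x)

/-- `T.HasGen x y` says that `(T(t) x - x) / t → y` as `t ↓ 0`, that is, `x` lies in the
domain of the generator, which maps it to `y`. -/
def HasGen (T : C0Semigroup X) (x y : X) : Prop :=
  Tendsto (T.quotient x) (𝓝[>] 0) (𝓝 y)

theorem HasGen.add {T : C0Semigroup X} {x y x' y' : X} (h : T.HasGen x y)
    (h' : T.HasGen x' y') : T.HasGen (x + x') (y + y') := by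
  refine (Tendsto.add h h').congr fun t => ?_
  simp only [quotient, map_add, ← smul_add]
  congr 1
  abel

theorem HasGen.smul {T : C0Semigroup X} {x y : X} (c : ℂ) (h : T.HasGen x y) :
    T.HasGen (c • x) (c • y) := by
  refine (Tendsto.const_smul h c).congr fun t => ?_
  simp only [quotient, map_smul, ← smul_sub]
  rw [smul_comm]

theorem HasGen.zero (T : C0Semigroup X) : T.HasGen 0 0 := by
  refine tendsto_const_nhds.congr fun t => ?_
  simp [quotient]

/-- The (in general unbounded) infinitesimal generator: its domain is the set of all `x` for
which `lim_{t ↓ 0} (T(t) x - x) / t` exists, and it maps `x` to this limit. -/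
noncomputable def generator (T : C0Semigroup X) : X →ₗ.[ℂ] X where
  domain :=
    { carrier := {x | ∃ y, T.HasGen x y}
      add_mem' := fun ⟨_, h⟩ ⟨_, h'⟩ => ⟨_, h.add h'⟩
      zero_mem' := ⟨0, HasGen.zero T⟩
      smul_mem' := fun c _ ⟨_, h⟩ => ⟨_, h.smul c⟩ }
  toFun :=
    { toFun := fun x => Classical.choose x.2
      map_add' := fun x x' => tendsto_nhds_unique (Classical.choose_spec (x + x').2)
        ((Classical.choose_spec x.2).add (Classical.choose_spec x'.2))
      map_smul' := fun c x => tendsto_nhds_unique (Classical.choose_spec (c • x).2)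
        ((Classical.choose_spec x.2).smul c) }

end C0Semigroup

/-- The resolvent set of an unbounded operator `A`: all `z` for which `z - A` maps the domain
of `A` bijectively onto the whole space with a bounded inverse `R`. -/
def unboundedResolventSet {X : Type*} [NormedAddCommGroup X] [NormedSpace ℂ X]
    (A : X →ₗ.[ℂ] X) : Set ℂ :=
  {z | ∃ R : X →L[ℂ] X,
    (∀ y : X, ∃ h : R y ∈ A.domain, z • R y - A ⟨R y, h⟩ = y) ∧
    (∀ x : A.domain, R (z • (x : X) - A x) = x)}

/-- The spectrum of an unbounded operator: the complement of its resolvent set. -/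
def unboundedSpectrum {X : Type*} [NormedAddCommGroup X] [NormedSpace ℂ X]
    (A : X →ₗ.[ℂ] X) : Set ℂ :=
  (unboundedResolventSet A)ᶜ

/-- A function in complex `L²` is nonnegative if almost all its values are nonnegative reals. -/
def L2Nonneg {Ω : Type*} [MeasurableSpace Ω] {μ : Measure Ω} (f : Lp ℂ 2 μ) : Prop :=
  ∀ᵐ x ∂μ, 0 ≤ (f x).re ∧ (f x).im = 0

/-- A semigroup on complex `L²` is positive if each of its operators maps nonnegative functions
to nonnegative functions. -/
def C0Semigroup.IsPositive {Ω : Type*} [MeasurableSpace Ω] {μ : Measure Ω}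
    (T : C0Semigroup (Lp ℂ 2 μ)) : Prop :=
  ∀ (t : ℝ≥0) (f : Lp ℂ 2 μ), L2Nonneg f → L2Nonneg (T.op t f)

/-! On the circle ℝ/2πℤ take D f = f' + 2f + f(· + 1). In the Fourier basis it is diagonal with
entries m_k = ik + 2 + e^{ik}. Since π is irrational, Re m_k = 2 + cos k never equals 1. As |Im m_k|
→ ∞, each z with Re z = 1 has positive distance from all m_k, so it lies in the resolvent set
(`mem_resolventSet_generator_diagSemigroup`); this distance is not uniform along the line.

At time 2π the factor e^{2πik} is 1, so the eigenvalues are exp(2π(2 + e^{ik})). The integers are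
dense modulo 2π, so e^{ik} comes arbitrarily near -1 and the eigenvalues accumulate at e^{2π}
(`exp_two_pi_mem_closure`, `mem_spectrum_diagSemigroup_op`).

Positivity follows from e^{tD} f = e^{2t} ∑_j (t^j / j!) f(· + t + j), a limit of nonnegative
combinations of translations (`tendsto_partialSum`). -/

/-! ### Diagonal operators in a Hilbert basis -/

namespace HilbertBasis

variable {ι H : Type*} [NormedAddCommGroup H] [InnerProductSpace ℂ H]

theorem hasSum_norm_sq_repr (b : HilbertBasis ι ℂ H) (x : H) :
    HasSum (fun k => ‖b.repr x k‖ ^ 2) (‖x‖ ^ 2) := by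
  have h := lp.hasSum_norm (p := 2) (by simp) (b.repr x)
  simpa using h

theorem ext_repr (b : HilbertBasis ι ℂ H) {x y : H} (h : ∀ k, b.repr x k = b.repr y k) :
    x = y :=
  b.repr.injective (lp.ext (funext h))

theorem repr_sub_apply (b : HilbertBasis ι ℂ H) (x y : H) (k : ι) :
    b.repr (x - y) k = b.repr x k - b.repr y k := by
  rw [map_sub]; rfl

theorem repr_smul_apply (b : HilbertBasis ι ℂ H) (c : ℂ) (x : H) (k : ι) :
    b.repr (c • x) k = c * b.repr x k := by
  rw [map_smul]; rfl

/-- Dominated convergence in coordinates with respect to a Hilbert basis. -/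
theorem tendsto_of_repr_dominated (b : HilbertBasis ι ℂ H) {α : Type*} {l : Filter α}
    {y : α → H} {z x : H} (C : ℝ) (hle : ∀ᶠ t in l, ∀ k, ‖b.repr (y t - z) k‖ ≤ C * ‖b.repr x k‖)
    (hlim : ∀ k, Tendsto (fun t => b.repr (y t) k) l (𝓝 (b.repr z k))) :
    Tendsto y l (𝓝 z) := by
  rw [tendsto_iff_norm_sub_tendsto_zero]
  have h1 : Tendsto (fun t => ∑' k, ‖b.repr (y t - z) k‖ ^ 2) l (𝓝 (∑' _ : ι, (0 : ℝ))) := by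
    refine tendsto_tsum_of_dominated_convergence
      (bound := fun k => C ^ 2 * ‖b.repr x k‖ ^ 2)
      ((b.hasSum_norm_sq_repr x).summable.mul_left _) (fun k => ?_) ?_
    · have := (tendsto_iff_norm_sub_tendsto_zero.1 (hlim k)).pow 2
      simpa using this
    · filter_upwards [hle] with t ht k
      rw [← mul_pow, Real.norm_of_nonneg (by positivity)]
      exact pow_le_pow_left₀ (norm_nonneg _) (ht k) 2
  simp only [(b.hasSum_norm_sq_repr _).tsum_eq, tsum_zero] at h1
  simpa using h1.sqrt

/-- The operator that multiplies the `k`-th coordinate by `a k`, for bounded `a`. -/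
noncomputable def diag (b : HilbertBasis ι ℂ H) (a : ι → ℂ) (C : ℝ) (ha : ∀ k, ‖a k‖ ≤ C) :
    H →L[ℂ] H :=
  have hle (x : H) (k : ι) : ‖a k * b.repr x k‖ ^ 2 ≤ C ^ 2 * ‖b.repr x k‖ ^ 2 := by
    rw [norm_mul, mul_pow]
    gcongr
    exact ha k
  have hmem (x : H) : Memℓp (fun k => a k * b.repr x k) 2 := by
    refine memℓp_gen ?_
    refine Summable.of_nonneg_of_le (fun k => by positivity) (fun k => ?_)
      ((b.hasSum_norm_sq_repr x).summable.mul_left (C ^ 2))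
    simpa using hle x k
  LinearMap.mkContinuous
    { toFun := fun x => b.repr.symm (⟨fun k => a k * b.repr x k, hmem x⟩ : lp (fun _ : ι => ℂ) 2)
      map_add' := fun x y => b.ext_repr fun k => by
        simp only [map_add, LinearIsometryEquiv.apply_symm_apply]
        exact mul_add _ _ _
      map_smul' := fun c x => b.ext_repr fun k => by simp [mul_left_comm] } |C| <| fun x => by
    refine abs_le_of_sq_le_sq' ?_ (by positivity) |>.2
    rw [mul_pow, sq_abs]
    refine hasSum_le (fun k => ?_) (b.hasSum_norm_sq_repr _)
      ((b.hasSum_norm_sq_repr x).mul_left (C ^ 2))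
    simpa using hle x k

@[simp]
theorem repr_diag (b : HilbertBasis ι ℂ H) (a : ι → ℂ) (C : ℝ) (ha : ∀ k, ‖a k‖ ≤ C) (x : H)
    (k : ι) : b.repr (b.diag a C ha x) k = a k * b.repr x k := by
  simp [diag]

end HilbertBasis

/-- Mean value inequality. Only an upper bound on Re z enters the exponential factor, so the
difference quotients are dominated uniformly in k by a multiple of |m_k|. -/
theorem Complex.norm_exp_mul_sub_one_le {z : ℂ} {w t : ℝ} (ht : 0 ≤ t) (ht1 : t ≤ 1)
    (hw : 0 ≤ w) (hz : z.re ≤ w) :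
    ‖Complex.exp (t * z) - 1‖ ≤ Real.exp w * ‖z‖ * t := by
  have h := norm_image_sub_le_of_norm_deriv_le_segment' (a := 0) (b := t)
    (f := fun s : ℝ => Complex.exp (s * z)) (f' := fun s : ℝ => Complex.exp (s * z) * z)
    (C := Real.exp w * ‖z‖) (fun s _ => ?_) (fun s hs => ?_) t ⟨ht, le_rfl⟩
  · simpa using h
  · have h1 : HasDerivAt (fun s : ℝ => (s : ℂ) * z) z s := by
      simpa using (Complex.ofRealCLM.hasDerivAt (x := s)).mul_const z
    exact h1.cexp.hasDerivWithinAt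
  · rw [norm_mul, Complex.norm_exp]
    gcongr
    simp only [Complex.re_ofReal_mul]
    nlinarith [hs.1, hs.2]

/-! ### Diagonal semigroups: generator, resolvent and spectrum -/

namespace HilbertBasis

variable {ι H : Type*} [NormedAddCommGroup H] [InnerProductSpace ℂ H]

theorem norm_exp_mul_le {m : ℂ} {w : ℝ} (hm : m.re ≤ w) (t : ℝ≥0) :
    ‖Complex.exp ((t : ℝ) * m)‖ ≤ Real.exp (t * w) := by
  rw [Complex.norm_exp, Complex.re_ofReal_mul]
  gcongr

/-- The semigroup whose operators are diagonal with entries `exp (t m k)`. -/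
noncomputable def diagSemigroup (b : HilbertBasis ι ℂ H) (m : ι → ℂ) (w : ℝ)
    (hm : ∀ k, (m k).re ≤ w) : C0Semigroup H where
  op t := b.diag (fun k => Complex.exp ((t : ℝ) * m k)) _ fun k => norm_exp_mul_le (hm k) t
  op_zero := by
    ext x
    exact b.ext_repr fun k => by simp
  op_add s t := by
    ext x
    refine b.ext_repr fun k => ?_
    simp [add_mul, Complex.exp_add, mul_assoc]
  strong_cont x := by
    refine continuous_iff_continuousAt.2 fun t₀ => ?_
    have hc : Continuous fun t : ℝ≥0 => Real.exp (t * w) := by fun_prop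
    refine b.tendsto_of_repr_dominated (x := x) (Real.exp (t₀ * w) + 1 + Real.exp (t₀ * w)) ?_ ?_
    · filter_upwards [hc.continuousAt.eventually_lt_const
        (lt_add_one (Real.exp (t₀ * w)))] with t ht k
      rw [repr_sub_apply, repr_diag, repr_diag, ← sub_mul, norm_mul]
      gcongr
      refine (norm_sub_le _ _).trans (add_le_add ?_ (norm_exp_mul_le (hm k) t₀))
      exact (norm_exp_mul_le (hm k) t).trans ht.le
    · intro k
      simp only [repr_diag]
      have : Continuous fun t : ℝ≥0 => Complex.exp ((t : ℝ) * m k) * b.repr x k := by fun_prop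
      exact this.tendsto t₀

variable (b : HilbertBasis ι ℂ H) (m : ι → ℂ) (w : ℝ) (hm : ∀ k, (m k).re ≤ w)

@[simp]
theorem repr_diagSemigroup (t : ℝ≥0) (x : H) (k : ι) :
    b.repr ((b.diagSemigroup m w hm).op t x) k = Complex.exp ((t : ℝ) * m k) * b.repr x k :=
  b.repr_diag (fun k => Complex.exp ((t : ℝ) * m k)) _ (fun k => norm_exp_mul_le (hm k) t) x k

theorem repr_quotient (t : ℝ≥0) (x : H) (k : ι) :
    b.repr ((b.diagSemigroup m w hm).quotient x t) k =
      (((t : ℝ) : ℂ))⁻¹ * (Complex.exp ((t : ℝ) * m k) - 1) * b.repr x k := by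
  simp only [C0Semigroup.quotient, repr_smul_apply, repr_sub_apply, repr_diagSemigroup]
  ring

theorem tendsto_exp_quotient (z : ℂ) :
    Tendsto (fun t : ℝ≥0 => (((t : ℝ) : ℂ))⁻¹ * (Complex.exp ((t : ℝ) * z) - 1))
      (𝓝[>] 0) (𝓝 z) := by
  have h1 : HasDerivAt (fun s : ℝ => Complex.exp ((s : ℂ) * z)) z 0 := by
    have : HasDerivAt (fun s : ℝ => (s : ℂ) * z) z 0 := by
      simpa using (Complex.ofRealCLM.hasDerivAt (x := 0)).mul_const z
    simpa using this.cexp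
  have h2 := h1.tendsto_slope_zero_right
  have h3 : Tendsto (fun t : ℝ≥0 => (t : ℝ)) (𝓝[>] 0) (𝓝[>] 0) := by
    refine tendsto_nhdsWithin_iff.2 ⟨?_, ?_⟩
    · exact (NNReal.continuous_coe.tendsto' 0 0 rfl).mono_left nhdsWithin_le_nhds
    · filter_upwards [self_mem_nhdsWithin] with t ht
      exact NNReal.coe_pos.2 ht
  simpa [Function.comp_def] using h2.comp h3

theorem repr_of_hasGen {x y : H} (h : (b.diagSemigroup m w hm).HasGen x y) (k : ι) :
    b.repr y k = m k * b.repr x k := by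
  have hc : Continuous fun v : H => b.repr v k := by
    simp only [b.repr_apply_apply]
    fun_prop
  refine tendsto_nhds_unique ((hc.tendsto y).comp h) ?_
  simpa [Function.comp_def, repr_quotient] using
    (tendsto_exp_quotient (m k)).mul_const (b.repr x k)

theorem hasGen_of_repr {x y : H} (h : ∀ k, b.repr y k = m k * b.repr x k) :
    (b.diagSemigroup m w hm).HasGen x y := by
  -- The dominating vector is y itself: its coordinates already contain the factor m_k. The summand
  -- 1 accounts for subtracting the limit.
  refine b.tendsto_of_repr_dominated (x := y) (Real.exp |w| + 1) ?_ fun k => ?_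
  · have h1 : ∀ᶠ t : ℝ≥0 in 𝓝[>] 0, t < 1 :=
      nhdsWithin_le_nhds (eventually_lt_nhds one_pos)
    filter_upwards [h1, self_mem_nhdsWithin] with t ht1 ht0 k
    have ht0' : (0 : ℝ) < t := NNReal.coe_pos.2 ht0
    have h2 := Complex.norm_exp_mul_sub_one_le (z := m k) t.coe_nonneg ht1.le (abs_nonneg w)
      ((hm k).trans (le_abs_self w))
    rw [repr_sub_apply, repr_quotient, add_mul, one_mul]
    refine (norm_sub_le _ _).trans (add_le_add ?_ le_rfl)
    rw [h k, norm_mul, norm_mul, norm_mul, norm_inv, ← mul_assoc]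
    refine mul_le_mul_of_nonneg_right ?_ (norm_nonneg _)
    rw [Complex.norm_real, Real.norm_of_nonneg t.coe_nonneg, inv_mul_le_iff₀ ht0']
    exact h2.trans_eq (mul_comm _ _)
  · simp only [repr_quotient, h k]
    exact (tendsto_exp_quotient (m k)).mul_const (b.repr x k)

theorem mem_resolventSet_generator_diagSemigroup {z : ℂ} {C : ℝ} (hz : ∀ k, z ≠ m k)
    (hC : ∀ k, ‖(z - m k)⁻¹‖ ≤ C) :
    z ∈ unboundedResolventSet (b.diagSemigroup m w hm).generator := by
  set T := b.diagSemigroup m w hm with hT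
  have hgen (x : T.generator.domain) : T.HasGen (x : H) (T.generator x) :=
    Classical.choose_spec x.2
  refine ⟨b.diag (fun k => (z - m k)⁻¹) C hC, fun y => ?_, fun x => ?_⟩
  · have h : T.HasGen (b.diag (fun k => (z - m k)⁻¹) C hC y)
        (z • b.diag (fun k => (z - m k)⁻¹) C hC y - y) := by
      refine b.hasGen_of_repr m w hm fun k => ?_
      have := sub_ne_zero.2 (hz k)
      simp only [repr_smul_apply, repr_sub_apply, repr_diag]
      field_simp
      ring
    refine ⟨⟨_, h⟩, ?_⟩
    rw [tendsto_nhds_unique (hgen ⟨_, ⟨_, h⟩⟩) h]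
    abel
  · refine b.ext_repr fun k => ?_
    have := sub_ne_zero.2 (hz k)
    have h := b.repr_of_hasGen m w hm (hgen x) k
    simp only [repr_smul_apply, repr_sub_apply, repr_diag, h]
    field_simp

/-- Each b k is an eigenvector, so an inverse K of z - T(t) would keep z at distance at least 1/‖K‖
from every eigenvalue. -/
theorem mem_spectrum_diagSemigroup_op (t : ℝ≥0) {z : ℂ}
    (hz : z ∈ closure (Set.range fun k => Complex.exp ((t : ℝ) * m k))) :
    z ∈ spectrum ℂ ((b.diagSemigroup m w hm).op t) := by
  intro hu
  obtain ⟨u, hu⟩ := hu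
  set K : H →L[ℂ] H := ↑u⁻¹ with hK
  obtain ⟨_, ⟨k, rfl⟩, hk⟩ := Metric.mem_closure_iff.1 hz (‖K‖ + 1)⁻¹ (by positivity)
  have h1 : K ((u : H →L[ℂ] H) (b k)) = b k := by
    rw [← mul_apply_eq_comp, hK, Units.inv_mul]; rfl
  have h2 : (u : H →L[ℂ] H) (b k) = (z - Complex.exp ((t : ℝ) * m k)) • b k := by
    classical
    rw [hu]
    refine b.ext_repr fun j => ?_
    simp only [sub_apply, Algebra.algebraMap_eq_smul_one, smul_apply,
      one_apply_eq_self, repr_smul_apply, repr_sub_apply, repr_diagSemigroup]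
    rcases eq_or_ne j k with rfl | hj
    · ring
    · simp [b.repr_self, hj]
  have hn : ‖b k‖ = 1 := b.orthonormal.1 k
  have h3 : 1 ≤ ‖K‖ * ‖z - Complex.exp ((t : ℝ) * m k)‖ := by
    have := K.le_opNorm ((u : H →L[ℂ] H) (b k))
    rwa [h1, h2, norm_smul, hn, mul_one] at this
  rw [dist_eq_norm] at hk
  have h4 : (‖K‖ + 1) * ‖z - Complex.exp ((t : ℝ) * m k)‖ < 1 := by
    rwa [← lt_inv_mul_iff₀ (by positivity), mul_one]
  nlinarith [norm_nonneg (z - Complex.exp ((t : ℝ) * m k))]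

end HilbertBasis

/-! ### The closed cone of nonnegative functions -/

namespace L2Nonneg

variable {Ω : Type*} [MeasurableSpace Ω] {μ : Measure Ω}

theorem zero : L2Nonneg (0 : Lp ℂ 2 μ) := by
  filter_upwards [Lp.coeFn_zero ℂ 2 μ] with x hx
  rw [hx]
  simp

theorem add {f g : Lp ℂ 2 μ} (hf : L2Nonneg f) (hg : L2Nonneg g) : L2Nonneg (f + g) := by
  filter_upwards [Lp.coeFn_add f g, hf, hg] with x hx h1 h2
  rw [hx]
  exact ⟨add_nonneg h1.1 h2.1, by simp [h1.2, h2.2]⟩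

theorem smul {f : Lp ℂ 2 μ} (hf : L2Nonneg f) {c : ℝ} (hc : 0 ≤ c) : L2Nonneg ((c : ℂ) • f) := by
  filter_upwards [Lp.coeFn_smul (c : ℂ) f, hf] with x hx h1
  rw [hx]
  exact ⟨by simpa using mul_nonneg hc h1.1, by simp [h1.2]⟩

theorem sum {α : Type*} (s : Finset α) {f : α → Lp ℂ 2 μ} (hf : ∀ i ∈ s, L2Nonneg (f i)) :
    L2Nonneg (∑ i ∈ s, f i) :=
  Finset.sum_induction f L2Nonneg (fun _ _ => add) zero hf

/-- A subsequence of an L²-convergent sequence converges almost everywhere. -/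
theorem of_tendsto {f : ℕ → Lp ℂ 2 μ} {g : Lp ℂ 2 μ} (h : Tendsto f atTop (𝓝 g))
    (hf : ∀ n, L2Nonneg (f n)) : L2Nonneg g := by
  obtain ⟨ns, -, hns⟩ := (tendstoInMeasure_of_tendsto_Lp h).exists_seq_tendsto_ae
  filter_upwards [hns, ae_all_iff.2 hf] with x hx hfx
  refine ⟨ge_of_tendsto' ((Complex.continuous_re.tendsto _).comp hx) fun i => (hfx _).1, ?_⟩
  refine tendsto_nhds_unique ((Complex.continuous_im.tendsto _).comp hx) ?_
  exact tendsto_const_nhds.congr fun i => (hfx _).2.symm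

theorem compMeasurePreserving {f : Lp ℂ 2 μ} (hf : L2Nonneg f) {φ : Ω → Ω}
    (hφ : MeasurePreserving φ μ μ) : L2Nonneg (Lp.compMeasurePreserving φ hφ f) := by
  filter_upwards [Lp.coeFn_compMeasurePreserving f hφ, hφ.quasiMeasurePreserving.ae hf] with x hx h
  rwa [hx]

end L2Nonneg

/-! ### Translations on the circle and the counterexample -/

namespace AddCircle

variable {T : ℝ} [hT : Fact (0 < T)]

/-- Translation of the argument multiplies the Fourier coefficients by characters. -/
theorem fourierBasis_repr_compMeasurePreserving_add_right (f : Lp ℂ 2 (haarAddCircle (T := T)))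
    (s : AddCircle T) (k : ℤ) :
    fourierBasis.repr (Lp.compMeasurePreserving (· + s)
      (measurePreserving_add_right haarAddCircle s) f) k =
      fourier k s * fourierBasis.repr f k := by
  rw [fourierBasis_repr, fourierBasis_repr, fourierCoeff_congr_ae
    (Lp.coeFn_compMeasurePreserving f (measurePreserving_add_right haarAddCircle s))]
  simp only [fourierCoeff, Function.comp_apply]
  rw [← integral_const_mul, ← integral_add_right_eq_self (μ := haarAddCircle)
    (fun t => fourier k s * (fourier (-k) t • f t)) s]
  refine integral_congr_ae (Eventually.of_forall fun t => ?_)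
  have h : fourier (-k) s * fourier k s = 1 := by
    rw [← fourier_add, neg_add_cancel, fourier_zero]
  have h2 : fourier (-k) (t + s) = fourier (-k) t * fourier (-k) s := by
    simp [fourier_apply, smul_add, toCircle_add]
  simp only [smul_eq_mul, h2]
  linear_combination (-(fourier (-k) t * f (t + s))) * h

end AddCircle

namespace TranslationSemigroup

open AddCircle Complex

/-- The symbol of the operator `f ↦ f' + 2 f + f (· + 1)` on `2π`-periodic functions. -/
noncomputable def symbol (k : ℤ) : ℂ := k * I + 2 + exp (k * I)

theorem symbol_re (k : ℤ) : (symbol k).re = 2 + Real.cos k := by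
  simp [symbol, exp_re]

theorem symbol_im (k : ℤ) : (symbol k).im = k + Real.sin k := by
  simp [symbol, exp_im]

theorem symbol_re_le (k : ℤ) : (symbol k).re ≤ 3 := by
  rw [symbol_re]
  linarith [Real.cos_le_one k]

theorem symbol_re_ne_one (k : ℤ) : (symbol k).re ≠ 1 := by
  rw [symbol_re]
  intro h
  have hc : Real.cos k = -1 := by linarith
  obtain ⟨n, hn⟩ := Real.cos_eq_neg_one_iff.1 hc
  have hn' : Real.pi * ((1 + 2 * n : ℤ) : ℝ) = (k : ℝ) := by
    push_cast
    linarith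
  have h1 : (1 + 2 * n : ℤ) ≠ 0 := by omega
  exact (irrational_pi.mul_intCast h1).ne_int k hn'

theorem exists_norm_inv_sub_symbol_le (z : ℂ) :
    ∃ C : ℝ, ∀ k, ‖(z - symbol k)⁻¹‖ ≤ C := by
  -- Since Im m_k = k + sin k, any |k| > |Im z| + 2 gives |z - m_k| ≥ 1; the remaining finitely many
  -- k are summed into the constant.
  obtain ⟨M, hM⟩ := exists_nat_ge (|z.im| + 2)
  refine ⟨1 + ∑ k ∈ Finset.Icc (-(M : ℤ)) M, ‖(z - symbol k)⁻¹‖, fun k => ?_⟩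
  by_cases hk : k ∈ Finset.Icc (-(M : ℤ)) M
  · have := Finset.single_le_sum (f := fun k => ‖(z - symbol k)⁻¹‖)
      (fun _ _ => norm_nonneg _) hk
    linarith
  · have hk' : (M : ℝ) < |(k : ℝ)| := by
      rw [Finset.mem_Icc, ← abs_le, not_le] at hk
      exact_mod_cast hk
    have h1 : 1 ≤ ‖z - symbol k‖ := by
      refine le_trans ?_ (abs_im_le_norm _)
      rw [sub_im, symbol_im]
      have h2 := abs_sub_abs_le_abs_sub (k : ℝ) (z.im - Real.sin k)
      have h3 := abs_sub z.im (Real.sin k)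
      have h4 := Real.abs_sin_le_one k
      rw [show z.im - (k + Real.sin k) = -(k - (z.im - Real.sin k)) by ring, abs_neg]
      linarith
    have h5 : 0 ≤ ∑ k ∈ Finset.Icc (-(M : ℤ)) M, ‖(z - symbol k)⁻¹‖ :=
      Finset.sum_nonneg fun _ _ => norm_nonneg _
    rw [norm_inv]
    linarith [inv_le_one_of_one_le₀ h1]

theorem exp_two_pi_mem_closure :
    (Real.exp (2 * Real.pi) : ℂ) ∈
      closure (Set.range fun k : ℤ => exp ((2 * Real.pi : ℝ) * symbol k)) := by
  have hirr : Irrational (1 / (2 * Real.pi)) := by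
    rw [one_div, irrational_inv_iff]
    exact_mod_cast irrational_pi.natCast_mul two_ne_zero
  have hd := AddCircle.denseRange_zsmul_coe_iff.2 hirr
  set g : AddCircle (2 * Real.pi) → ℂ := fun x => exp ((2 * Real.pi : ℝ) * (2 + fourier 1 x))
    with hg
  have hgc : Continuous g := by
    have := (fourier (T := 2 * Real.pi) 1).continuous
    fun_prop
  have hgr (x : ℝ) : g x = exp ((2 * Real.pi : ℝ) * (2 + exp (x * I))) := by
    have hpi : (Real.pi : ℂ) ≠ 0 := by exact_mod_cast Real.pi_ne_zero
    simp only [hg, fourier_coe_apply]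
    congr 4
    push_cast
    field_simp
  have h1 : g (Real.pi : ℝ) = Real.exp (2 * Real.pi) := by
    rw [hgr, exp_pi_mul_I, ofReal_exp]
    congr 1
    ring
  rw [← h1]
  refine closure_mono ?_ (image_closure_subset_closure_image hgc ⟨_, hd (Real.pi : ℝ), rfl⟩)
  rintro _ ⟨_, ⟨k, rfl⟩, rfl⟩
  refine ⟨k, ?_⟩
  have h2 : k • ((1 : ℝ) : AddCircle (2 * Real.pi)) = ((k : ℝ) : AddCircle (2 * Real.pi)) := by
    rw [← AddCircle.coe_zsmul, zsmul_one]
  simp only [h2, hgr, symbol, ofReal_intCast]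
  -- The exponents differ by 2π · ik, which is k periods of exp.
  refine exp_eq_exp_iff_exists_int.2 ⟨k, ?_⟩
  push_cast
  ring

variable [hT : Fact (0 < 2 * Real.pi)]

/-- The positive semigroup on `L²` of the circle generated by `f ↦ f' + 2 f + f (· + 1)`. -/
noncomputable def semigroup :
    C0Semigroup (Lp ℂ 2 (haarAddCircle (T := 2 * Real.pi))) :=
  fourierBasis.diagSemigroup symbol 3 symbol_re_le

theorem repr_translate (f : Lp ℂ 2 (haarAddCircle (T := 2 * Real.pi))) (s : ℝ) (k : ℤ) :
    fourierBasis.repr (Lp.compMeasurePreserving (· + (s : AddCircle (2 * Real.pi)))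
      (measurePreserving_add_right haarAddCircle _) f) k =
      exp (k * s * I) * fourierBasis.repr f k := by
  have hpi : (Real.pi : ℂ) ≠ 0 := by exact_mod_cast Real.pi_ne_zero
  rw [fourierBasis_repr_compMeasurePreserving_add_right, fourier_coe_apply]
  congr 2
  push_cast
  field_simp

/-- Partial sums of the exponential series of the semigroup. -/
noncomputable def partialSum (t : ℝ≥0) (f : Lp ℂ 2 (haarAddCircle (T := 2 * Real.pi))) (N : ℕ) :
    Lp ℂ 2 (haarAddCircle (T := 2 * Real.pi)) :=
  ∑ j ∈ Finset.range N, ((Real.exp (2 * t) * ((t : ℝ) ^ j / j.factorial) : ℝ) : ℂ) •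
    Lp.compMeasurePreserving (· + ((t + j : ℝ) : AddCircle (2 * Real.pi)))
      (measurePreserving_add_right haarAddCircle _) f

theorem repr_partialSum (t : ℝ≥0) (f : Lp ℂ 2 (haarAddCircle (T := 2 * Real.pi))) (N : ℕ)
    (k : ℤ) :
    fourierBasis.repr (partialSum t f N) k =
      exp (2 * (t : ℝ) + k * (t : ℝ) * I) *
        (∑ j ∈ Finset.range N, ((t : ℝ) * exp (k * I)) ^ j / j.factorial) *
          fourierBasis.repr f k := by
  rw [partialSum, map_sum, lp.coeFn_sum, Finset.sum_apply, Finset.mul_sum, Finset.sum_mul]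
  refine Finset.sum_congr rfl fun j _ => ?_
  rw [HilbertBasis.repr_smul_apply, repr_translate, exp_add]
  have h : exp (k * ((t + j : ℝ) : ℂ) * I) = exp (k * (t : ℝ) * I) * exp (k * I) ^ j := by
    rw [← exp_nat_mul, ← exp_add]
    congr 1
    push_cast
    ring
  rw [h]
  push_cast
  ring

theorem tendsto_partialSum (t : ℝ≥0) (f : Lp ℂ 2 (haarAddCircle (T := 2 * Real.pi))) :
    Tendsto (partialSum t f) atTop (𝓝 (semigroup.op t f)) := by
  have hexp (k : ℤ) : exp ((t : ℝ) * symbol k) =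
      exp (2 * (t : ℝ) + k * (t : ℝ) * I) * exp ((t : ℝ) * exp (k * I)) := by
    rw [← exp_add, symbol]
    congr 1
    ring
  have hunit (k : ℤ) : ‖exp (k * I)‖ = 1 := by
    simpa using norm_exp_ofReal_mul_I k
  -- The first summand bounds the multipliers of all partial sums, the second that of the limit.
  refine fourierBasis.tendsto_of_repr_dominated (x := f)
    (Real.exp (2 * t) * Real.exp t + Real.exp (t * 3))
    (Eventually.of_forall fun N k => ?_) fun k => ?_
  · rw [HilbertBasis.repr_sub_apply, repr_partialSum, semigroup,
      HilbertBasis.repr_diagSemigroup, ← sub_mul, norm_mul]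
    gcongr
    refine (norm_sub_le _ _).trans
      (add_le_add ?_ (HilbertBasis.norm_exp_mul_le (symbol_re_le k) t))
    rw [norm_mul, norm_exp]
    gcongr
    · simp
    · refine (norm_sum_le _ _).trans (le_trans (le_of_eq ?_)
        (Real.sum_le_exp_of_nonneg t.coe_nonneg N))
      refine Finset.sum_congr rfl fun j _ => ?_
      simp [hunit]
  · simp only [repr_partialSum, semigroup, HilbertBasis.repr_diagSemigroup, hexp]
    refine Tendsto.mul_const _ (Tendsto.const_mul _ ?_)
    have := (NormedSpace.expSeries_div_hasSum_exp ((t : ℝ) * exp (k * I))).tendsto_sum_nat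
    rwa [← exp_eq_exp_ℂ] at this

theorem semigroup_isPositive : semigroup.IsPositive := by
  intro t f hf
  refine L2Nonneg.of_tendsto (tendsto_partialSum t f) fun N => L2Nonneg.sum _ fun j _ => ?_
  exact (hf.compMeasurePreserving _).smul (by positivity)

end TranslationSemigroup

theorem theorem5 :
    ∃ (Ω : Type) (_ : MeasurableSpace Ω) (μ : Measure Ω) (_ : SigmaFinite μ)
      (T : C0Semigroup (Lp ℂ 2 μ)),
      T.IsPositive ∧
      {z : ℂ | z.re = 1} ∩ unboundedSpectrum T.generator = ∅ ∧
      (Real.exp (2 * Real.pi) : ℂ) ∈ spectrum ℂ (T.op (Real.toNNReal (2 * Real.pi))) ∧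
      ¬ (∀ (a : ℝ) (t : ℝ≥0), 0 < t →
          ({z : ℂ | z.re = a} ∩ unboundedSpectrum T.generator = ∅ ↔
            {z : ℂ | ‖z‖ = Real.exp (t * a)} ∩ spectrum ℂ (T.op t) = ∅)) := by
  have hT : Fact (0 < 2 * Real.pi) := ⟨Real.two_pi_pos⟩
  have hcoe : ((Real.toNNReal (2 * Real.pi) : ℝ≥0) : ℝ) = 2 * Real.pi :=
    Real.coe_toNNReal _ hT.out.le
  have hgen : {z : ℂ | z.re = 1} ∩
      unboundedSpectrum TranslationSemigroup.semigroup.generator = ∅ := by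
    refine Set.eq_empty_of_forall_notMem fun z ⟨hz, hs⟩ => hs ?_
    obtain ⟨C, hC⟩ := TranslationSemigroup.exists_norm_inv_sub_symbol_le z
    refine HilbertBasis.mem_resolventSet_generator_diagSemigroup _ _ _ _ (fun k h => ?_) hC
    exact TranslationSemigroup.symbol_re_ne_one k (h ▸ hz)
  have hspec : (Real.exp (2 * Real.pi) : ℂ) ∈
      spectrum ℂ (TranslationSemigroup.semigroup.op (Real.toNNReal (2 * Real.pi))) := by
    refine HilbertBasis.mem_spectrum_diagSemigroup_op _ _ _ _ _ ?_
    rw [hcoe]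
    exact TranslationSemigroup.exp_two_pi_mem_closure
  refine ⟨AddCircle (2 * Real.pi), inferInstance, AddCircle.haarAddCircle, inferInstance,
    TranslationSemigroup.semigroup, TranslationSemigroup.semigroup_isPositive, hgen, hspec,
    fun h => ?_⟩
  have h1 := (h 1 _ (Real.toNNReal_pos.2 hT.out)).1 hgen
  refine Set.notMem_empty (Real.exp (2 * Real.pi) : ℂ) (h1 ▸ ⟨?_, hspec⟩)
  rw [Set.mem_ofPred_eq, hcoe, mul_one, Complex.norm_real, Real.norm_of_nonneg (Real.exp_pos _).le]
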